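/- Let $0<\alpha<1$ and $\lambda<0$. There exist constants $c_\alpha>0$ and $T>0$, depending only on $\alpha$ and $\lambda$, such that the following holds. Let $f:\mathbb{R}\to\mathbb{R}$ satisfy the one-sided Lipschitz condition $$(f(u)-f(v))\,(u-v)\le \lambda\,|u-v|^2\qquad\text{for all }u,v\in\mathbb{R},$$ and let $x,y\in C[0,\infty)\cap C^1(0,\infty)$ be two solutions, with initial values $x(0)=x_0$ and $y(0)=y_0$, of the scalar Caputo fractional differential equation $${}^{C}_{0}D^{\alpha}_t x(t)=f(x(t)),\quad t>0,\qquad\text{where}\qquad {}^{C}_{0}D^{\alpha}_t x(t)=\frac{1}{\Gamma(1-\alpha)}\int_0^t\frac{x'(\tau)}{(t-\tau)^{\alpha}}\,d\tau$$ (the integral being absolutely convergent for every $t>0$). Then $$|x(t)-y(t)|\le |x_0-y_0|\,\frac{c_\alpha}{t^{\alpha}}\qquad\text{for all }t\ge T.$$ -/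

import Mathlib

/-- The Caputo fractional derivative of order `α ∈ (0, 1)`, based at `0`, of a scalar function:
`(1 / Γ(1 - α)) ∫₀ᵗ x'(τ) / (t - τ)^α dτ`. It is meaningful at `t > 0` when the integrand is
integrable on `(0, t)`; see `CaputoDifferentiableAt`. -/
noncomputable def caputoDeriv (α : ℝ) (x : ℝ → ℝ) (t : ℝ) : ℝ :=
  (1 / Real.Gamma (1 - α)) * ∫ τ in (0 : ℝ)..t, deriv x τ / (t - τ) ^ α

/-- The integral defining the Caputo derivative of `x` at `t` converges. -/
def CaputoDifferentiableAt (α : ℝ) (x : ℝ → ℝ) (t : ℝ) : Prop :=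
  IntervalIntegrable (fun τ : ℝ => deriv x τ / (t - τ) ^ α) MeasureTheory.volume 0 t

/-- The one-sided Lipschitz condition with constant `lam` for a scalar function `f`:
`⟨f u - f v, u - v⟩ ≤ lam ‖u - v‖²` for all `u, v`. -/
def OneSidedLipschitz (lam : ℝ) (f : ℝ → ℝ) : Prop :=
  ∀ u v : ℝ, inner ℝ (f u - f v) (u - v) ≤ lam * ‖u - v‖ ^ 2

/-- `x` is a solution in `C[0, ∞) ∩ C¹(0, ∞)` of the initial value problem for the scalar
fractional differential equation of order `α` with right-hand side `f` and initial value `x₀`: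
the Caputo derivative of `x` exists and equals `f (x t)` at every `t > 0`, and `x 0 = x₀`.
The values of `x` at negative arguments play no role. -/
structure IsCaputoSolution (α : ℝ) (f : ℝ → ℝ) (x₀ : ℝ) (x : ℝ → ℝ) : Prop where
  continuousOn : ContinuousOn x (Set.Ici 0)
  contDiffOn : ContDiffOn ℝ 1 x (Set.Ioi 0)
  initial : x 0 = x₀
  caputoDifferentiable : ∀ t : ℝ, 0 < t → CaputoDifferentiableAt α x t
  equation : ∀ t : ℝ, 0 < t → caputoDeriv α x t = f (x t)

open Set Filter Topology MeasureTheory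

/-! Comparison with an explicit barrier `φ(t) = (M + t) ^ (-α)`, which already decays at the claimed
rate. For `M` large, `D^α φ ≥ lam * φ` (`exists_rpow_supersolution`). If `w = x - y - A * φ` had a
positive maximum over `[0, s]`, attained at `t`, then `t > 0` by the choice of `A`, and `x t > y t`.
The one-sided Lipschitz condition then gives `D^α w(t) ≤ lam * w(t) < 0`, while the extremum
principle gives `D^α w(t) ≥ 0`. Exchanging `x` and `y` bounds the absolute value. -/

/-- The extremum principle for the Caputo derivative: if `w` attains its maximum over `[0, t]` at
the right end point, then the integral defining its Caputo derivative at `t` is nonnegative. -/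
theorem integral_deriv_div_rpow_nonneg_of_max {α t : ℝ} (hα0 : 0 < α) (hα1 : α < 1) (ht : 0 < t)
    {w w' : ℝ → ℝ} (hc : ContinuousOn w (Icc 0 t)) (hd : ∀ τ ∈ Ioc 0 t, HasDerivAt w (w' τ) τ)
    (hw' : ContinuousOn w' (Ioo 0 t))
    (hint : IntervalIntegrable (fun τ => w' τ / (t - τ) ^ α) volume 0 t)
    (hmax : ∀ τ ∈ Icc 0 t, w τ ≤ w t) :
    0 ≤ ∫ τ in (0 : ℝ)..t, w' τ / (t - τ) ^ α := by
  set k : ℝ → ℝ := fun τ => w' τ / (t - τ) ^ α with hk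
  set P : ℝ → ℝ := fun s => ∫ τ in (0 : ℝ)..s, k τ with hP
  have hPc : ContinuousOn P (Icc 0 t) := by
    have := intervalIntegral.continuousOn_primitive_interval (f := k) (a := 0) (b := t) (μ := volume)
      (by rw [uIcc_of_le ht.le]; exact (intervalIntegrable_iff_integrableOn_Icc_of_le ht.le).1 hint)
    rwa [uIcc_of_le ht.le] at this
  have hkc : ContinuousOn k (Ioo 0 t) := by
    refine hw'.div (ContinuousOn.rpow_const (by fun_prop) fun τ hτ => Or.inr hα0.le) fun τ hτ => ?_
    exact (Real.rpow_pos_of_pos (sub_pos.2 hτ.2) _).ne'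
  have hPd : ∀ s ∈ Ioo 0 t, HasDerivAt P (k s) s := fun s hs => by
    refine intervalIntegral.integral_hasDerivAt_right
      (hint.mono_set (by rw [uIcc_of_le ht.le, uIcc_of_le hs.1.le]; exact Icc_subset_Icc_right hs.2.le))
      (hkc.stronglyMeasurableAtFilter isOpen_Ioo s hs) (hkc.continuousAt (isOpen_Ioo.mem_nhds hs))
  -- Integration by parts in differential form: the added boundary term cancels `w'` in the
  -- derivative, leaving a multiple of `w t - w s ≥ 0`.
  set H : ℝ → ℝ := fun s => P s + (w t - w s) * (t - s) ^ (-α) with hH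
  have hHd : ∀ s ∈ Ioo 0 t, HasDerivAt H ((w t - w s) * (α * (t - s) ^ (-α - 1))) s := fun s hs => by
    have hts : 0 < t - s := sub_pos.2 hs.2
    have h1 : HasDerivAt (fun s => (t - s) ^ (-α)) (-1 * (-α) * (t - s) ^ (-α - 1)) s :=
      ((hasDerivAt_id s).const_sub t).rpow_const (Or.inl hts.ne')
    have h2 := (hPd s hs).add (((hd s ⟨hs.1, hs.2.le⟩).const_sub (w t)).mul h1)
    refine h2.congr_deriv ?_
    simp only [hk, Real.rpow_neg hts.le, div_eq_mul_inv]
    ring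
  have hHc : ContinuousOn H (Ico 0 t) := by
    refine (hPc.mono Ico_subset_Icc_self).add
      ((continuousOn_const.sub (hc.mono Ico_subset_Icc_self)).mul
        (ContinuousOn.rpow_const (by fun_prop) fun τ hτ => Or.inl (sub_pos.2 hτ.2).ne'))
  have hmono : MonotoneOn H (Ico 0 t) := by
    refine monotoneOn_of_deriv_nonneg (convex_Ico 0 t) hHc ?_ ?_ <;> rw [interior_Ico]
    · exact fun s hs => (hHd s hs).differentiableAt.differentiableWithinAt
    · intro s hs
      rw [(hHd s hs).deriv]
      have hts : 0 < t - s := sub_pos.2 hs.2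
      exact mul_nonneg (sub_nonneg.2 (hmax s ⟨hs.1.le, hs.2.le⟩)) (by positivity)
  have hH0 : 0 ≤ H 0 := by
    simp only [hH, hP, intervalIntegral.integral_same, zero_add, sub_zero]
    exact mul_nonneg (sub_nonneg.2 (hmax 0 ⟨le_rfl, ht.le⟩)) (by positivity)
  -- The boundary term is the slope of `w` times `(t - s) ^ (1 - α)`, so it vanishes in the limit.
  have hlim : Tendsto H (𝓝[<] t) (𝓝 (P t + w' t * 0)) := by
    refine Tendsto.add ?_ ?_
    · exact (hPc t ⟨ht.le, le_rfl⟩).mono_of_mem_nhdsWithin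
        (mem_of_superset (Ioo_mem_nhdsLT ht) Ioo_subset_Icc_self)
    · have hs : Tendsto (slope w t) (𝓝[<] t) (𝓝 (w' t)) :=
        (hasDerivAt_iff_tendsto_slope.1 (hd t ⟨ht, le_rfl⟩)).mono_left
          (nhdsWithin_mono _ fun s hs => ne_of_lt hs)
      have hr : Tendsto (fun s : ℝ => (t - s) ^ (1 - α)) (𝓝[<] t) (𝓝 0) := by
        have h : ContinuousAt (fun s : ℝ => (t - s) ^ (1 - α)) t :=
          ContinuousAt.rpow_const (by fun_prop) (Or.inr (by linarith))
        have h' : Tendsto _ (𝓝[<] t) _ := h.tendsto.mono_left nhdsWithin_le_nhds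
        simpa [Real.zero_rpow (show 1 - α ≠ 0 by linarith)] using h'
      refine (hs.mul hr).congr' ?_
      filter_upwards [self_mem_nhdsWithin] with s hst
      have hts : 0 < t - s := sub_pos.2 hst
      rw [slope_def_field, show 1 - α = 1 + -α by ring, Real.rpow_add hts, Real.rpow_one,
        ← neg_sub (w t), ← neg_sub t s]
      field_simp
  rw [mul_zero, add_zero] at hlim
  refine ge_of_tendsto hlim ?_
  filter_upwards [Ioo_mem_nhdsLT ht] with s hs
  exact hH0.trans (hmono ⟨le_rfl, ht⟩ ⟨hs.1.le, hs.2⟩ hs.1.le)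

/-- The singular kernel of the Caputo derivative is integrable. -/
theorem intervalIntegrable_sub_rpow_neg {α : ℝ} (hα1 : α < 1) (t : ℝ) :
    IntervalIntegrable (fun τ => (t - τ) ^ (-α)) volume 0 t := by
  have h : IntervalIntegrable (fun τ : ℝ => τ ^ (-α)) volume 0 t :=
    intervalIntegral.intervalIntegrable_rpow' (by linarith)
  simpa using (h.comp_sub_left t).symm

theorem integral_sub_rpow_neg {α : ℝ} (hα1 : α < 1) (t : ℝ) :
    ∫ τ in (0 : ℝ)..t, (t - τ) ^ (-α) = t ^ (1 - α) / (1 - α) := by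
  rw [intervalIntegral.integral_comp_sub_left (fun τ : ℝ => τ ^ (-α)), sub_self, sub_zero,
    integral_rpow (Or.inl (by linarith)), show -α + 1 = 1 - α by ring,
    Real.zero_rpow (by linarith), sub_zero]

theorem continuousOn_add_rpow {M : ℝ} (hM : 0 < M) (p : ℝ) :
    ContinuousOn (fun τ : ℝ => (M + τ) ^ p) (Ici 0) :=
  ContinuousOn.rpow_const (by fun_prop) fun τ hτ =>
    Or.inl (add_pos_of_pos_of_nonneg hM (mem_Ici.1 hτ)).ne'

theorem hasDerivAt_add_rpow_neg {M τ : ℝ} (hM : 0 < M + τ) (α : ℝ) :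
    HasDerivAt (fun s : ℝ => (M + s) ^ (-α)) (-α * (M + τ) ^ (-α - 1)) τ := by
  simpa using ((hasDerivAt_id τ).const_add M).rpow_const (p := -α) (Or.inl hM.ne')

theorem intervalIntegrable_add_rpow_div {α M t : ℝ} (hα1 : α < 1) (hM : 0 < M) (ht : 0 < t)
    (p : ℝ) : IntervalIntegrable (fun τ => (M + τ) ^ p / (t - τ) ^ α) volume 0 t := by
  have h := (intervalIntegrable_sub_rpow_neg hα1 t).continuousOn_mul (g := fun τ => (M + τ) ^ p)
    ((continuousOn_add_rpow hM p).mono (by rw [uIcc_of_le ht.le]; exact Icc_subset_Ici_self))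
  refine h.congr fun τ hτ => ?_
  rw [uIoc_of_le ht.le] at hτ
  simp only [Real.rpow_neg (sub_nonneg.2 hτ.2), div_eq_mul_inv]

/-- A pointwise bound for the integrand in the Caputo derivative of `(M + ·) ^ (-α)`, according to
which of the two factors is large. -/
theorem rpow_mul_rpow_neg_le {α a b : ℝ} (hα0 : 0 < α) (hα1 : α < 1) (ha : 0 < a) (hb : 0 < b) :
    a ^ (-α - 1) * b ^ (-α) ≤
      2 * (a + b) ^ (-α) * a ^ (-α - 1) + 4 * (a + b) ^ (-α - 1) * b ^ (-α) := by
  have hS : 0 < a + b := add_pos ha hb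
  -- Used with `c` the larger of `a` and `b`, which is at least half their sum.
  have key : ∀ q c : ℝ, 0 ≤ q → (a + b) / 2 ≤ c → c ^ (-q) ≤ 2 ^ q * (a + b) ^ (-q) := by
    intro q c hq hc
    refine (Real.rpow_le_rpow_of_nonpos (by positivity) hc (by linarith)).trans_eq ?_
    rw [Real.div_rpow hS.le zero_le_two, Real.rpow_neg zero_le_two q, div_inv_eq_mul, mul_comm]
  have pos1 : 0 < (a + b) ^ (-α) * a ^ (-α - 1) := by positivity
  have pos2 : 0 < (a + b) ^ (-α - 1) * b ^ (-α) := by positivity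
  rcases le_total a b with hab | hab
  · have h1 := key α b hα0.le (by linarith)
    have h2 : (2 : ℝ) ^ α ≤ 2 := by
      simpa using Real.rpow_le_rpow_of_exponent_le one_le_two hα1.le
    have h3 : b ^ (-α) ≤ 2 * (a + b) ^ (-α) := h1.trans (by gcongr)
    have h4 := mul_le_mul_of_nonneg_left h3 (Real.rpow_nonneg ha.le (-α - 1))
    nlinarith
  · have h1 := key (α + 1) a (by linarith) (by linarith)
    rw [show -(α + 1) = -α - 1 by ring] at h1
    have h2 : (2 : ℝ) ^ (α + 1) ≤ 4 := by
      have := Real.rpow_le_rpow_of_exponent_le one_le_two (show α + 1 ≤ 2 by linarith)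
      norm_num at this ⊢
      exact this
    have h3 : a ^ (-α - 1) ≤ 4 * (a + b) ^ (-α - 1) := h1.trans (by gcongr)
    have h4 := mul_le_mul_of_nonneg_right h3 (Real.rpow_nonneg hb.le (-α))
    nlinarith

/-- Both terms of the pointwise bound integrate explicitly. The gain is the factor `M ^ (-α)`,
uniform in `t`, which a large `M` makes as small as desired. -/
theorem integral_add_rpow_div_le {α M t : ℝ} (hα0 : 0 < α) (hα1 : α < 1) (hM : 0 < M)
    (ht : 0 < t) :
    ∫ τ in (0 : ℝ)..t, α * ((M + τ) ^ (-α - 1) / (t - τ) ^ α) ≤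
      (2 + 4 * α / (1 - α)) * M ^ (-α) * (M + t) ^ (-α) := by
  have hS : 0 < M + t := add_pos hM ht
  have hi1 : IntervalIntegrable (fun τ => α * (M + τ) ^ (-α - 1)) volume 0 t := by
    refine ContinuousOn.intervalIntegrable ?_
    rw [uIcc_of_le ht.le]
    exact continuousOn_const.mul ((continuousOn_add_rpow hM _).mono Icc_subset_Ici_self)
  have hi2 := intervalIntegrable_sub_rpow_neg hα1 t
  have hI1 : ∫ τ in (0 : ℝ)..t, α * (M + τ) ^ (-α - 1) = M ^ (-α) - (M + t) ^ (-α) := by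
    have := intervalIntegral.integral_eq_sub_of_hasDerivAt (a := 0) (b := t)
      (f := fun τ => -(M + τ) ^ (-α)) (f' := fun τ => α * (M + τ) ^ (-α - 1)) (fun τ hτ => by
        rw [uIcc_of_le ht.le] at hτ
        exact (hasDerivAt_add_rpow_neg (add_pos_of_pos_of_nonneg hM hτ.1) α).neg.congr_deriv
          (by ring)) hi1
    rw [this, add_zero]
    ring
  have hle : ∫ τ in (0 : ℝ)..t, α * ((M + τ) ^ (-α - 1) / (t - τ) ^ α) ≤
      ∫ τ in (0 : ℝ)..t, (2 * (M + t) ^ (-α) * (α * (M + τ) ^ (-α - 1)) +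
        4 * α * (M + t) ^ (-α - 1) * (t - τ) ^ (-α)) := by
    refine intervalIntegral.integral_mono_on_of_le_Ioo ht.le
      ((intervalIntegrable_add_rpow_div hα1 hM ht _).const_mul α)
      ((hi1.const_mul _).add (hi2.const_mul _)) fun τ hτ => ?_
    have hb : 0 < t - τ := sub_pos.2 hτ.2
    have h := rpow_mul_rpow_neg_le hα0 hα1 (add_pos hM hτ.1) hb
    rw [show M + τ + (t - τ) = M + t by ring] at h
    have h' := mul_le_mul_of_nonneg_left h hα0.le
    rw [div_eq_mul_inv, ← Real.rpow_neg hb.le]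
    linarith
  refine hle.trans ?_
  rw [intervalIntegral.integral_add (hi1.const_mul _) (hi2.const_mul _),
    intervalIntegral.integral_const_mul (2 * (M + t) ^ (-α)), hI1,
    intervalIntegral.integral_const_mul (4 * α * (M + t) ^ (-α - 1)),
    integral_sub_rpow_neg hα1]
  have h1α : 0 < 1 - α := by linarith
  have hsplit : (M + t) ^ (-α - 1) * t ^ (1 - α) ≤ (M + t) ^ (-α) * M ^ (-α) := by
    calc (M + t) ^ (-α - 1) * t ^ (1 - α) ≤ (M + t) ^ (-α - 1) * (M + t) ^ (1 - α) := by
          gcongr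
          linarith
      _ = (M + t) ^ (-α) * (M + t) ^ (-α) := by
          rw [← Real.rpow_add hS, ← Real.rpow_add hS]
          ring_nf
      _ ≤ (M + t) ^ (-α) * M ^ (-α) :=
          mul_le_mul_of_nonneg_left
            (Real.rpow_le_rpow_of_nonpos hM (by linarith) (by linarith)) (by positivity)
  have h1 : 0 < (M + t) ^ (-α) * (M + t) ^ (-α) := by positivity
  have h2 := mul_le_mul_of_nonneg_left hsplit (show 0 ≤ 4 * α / (1 - α) by positivity)
  calc _ = 2 * ((M + t) ^ (-α) * M ^ (-α)) - 2 * ((M + t) ^ (-α) * (M + t) ^ (-α)) +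
        4 * α / (1 - α) * ((M + t) ^ (-α - 1) * t ^ (1 - α)) := by ring
    _ ≤ _ := by linarith

/-- For large `M` the function `(M + ·) ^ (-α)` is a supersolution of the linear equation
`D^α u = lam * u`. -/
theorem exists_rpow_supersolution {α lam : ℝ} (hα0 : 0 < α) (hα1 : α < 1) (hlam : lam < 0) :
    ∃ M : ℝ, 0 < M ∧ ∀ t : ℝ, 0 < t →
      lam * (M + t) ^ (-α) ≤ (1 / Real.Gamma (1 - α)) *
        ∫ τ in (0 : ℝ)..t, -α * (M + τ) ^ (-α - 1) / (t - τ) ^ α := by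
  have h1α : 0 < 1 - α := by linarith
  have hG : 0 < Real.Gamma (1 - α) := Real.Gamma_pos_of_pos h1α
  set K : ℝ := 2 + 4 * α / (1 - α) with hK
  have hK0 : 0 < K := by positivity
  set B : ℝ := K / (Real.Gamma (1 - α) * -lam) with hB
  have hB0 : 0 < B := div_pos hK0 (mul_pos hG (neg_pos.2 hlam))
  -- Chosen so that `K * M ^ (-α)` equals `Γ(1 - α) * -lam` exactly.
  refine ⟨B ^ α⁻¹, by positivity, fun t ht => ?_⟩
  have hMα : (B ^ α⁻¹) ^ (-α) = B⁻¹ := by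
    rw [Real.rpow_neg (by positivity), Real.rpow_inv_rpow hB0.le hα0.ne']
  have h := integral_add_rpow_div_le hα0 hα1 (show 0 < B ^ α⁻¹ by positivity) ht
  rw [hMα, ← hK, show K * B⁻¹ = Real.Gamma (1 - α) * -lam by rw [hB]; field_simp] at h
  have hneg : ∫ τ in (0 : ℝ)..t, -α * (B ^ α⁻¹ + τ) ^ (-α - 1) / (t - τ) ^ α =
      -∫ τ in (0 : ℝ)..t, α * ((B ^ α⁻¹ + τ) ^ (-α - 1) / (t - τ) ^ α) := by
    rw [← intervalIntegral.integral_neg]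
    congr 1
    ext τ
    ring
  rw [hneg, one_div, ← div_eq_inv_mul, le_div_iff₀ hG]
  linarith

theorem IsCaputoSolution.hasDerivAt {α x₀ : ℝ} {f x : ℝ → ℝ} (hx : IsCaputoSolution α f x₀ x)
    {t : ℝ} (ht : 0 < t) : HasDerivAt x (deriv x t) t :=
  ((hx.contDiffOn.differentiableOn one_ne_zero).differentiableAt (Ioi_mem_nhds ht)).hasDerivAt

/-- A supersolution of `D^α u = lam * u` of the form `A * (M + ·) ^ (-α)` bounds the difference of
two solutions from above. -/
theorem IsCaputoSolution.sub_le {α lam M A : ℝ} (hα0 : 0 < α) (hα1 : α < 1) (hlam : lam < 0)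
    (hM : 0 < M)
    (hsuper : ∀ t : ℝ, 0 < t → lam * (M + t) ^ (-α) ≤ (1 / Real.Gamma (1 - α)) *
        ∫ τ in (0 : ℝ)..t, -α * (M + τ) ^ (-α - 1) / (t - τ) ^ α)
    {f : ℝ → ℝ} (hf : OneSidedLipschitz lam f) {x₀ y₀ : ℝ} {x y : ℝ → ℝ}
    (hx : IsCaputoSolution α f x₀ x) (hy : IsCaputoSolution α f y₀ y) (hA0 : 0 ≤ A)
    (hA : x₀ - y₀ ≤ A * M ^ (-α)) {s : ℝ} (hs : 0 ≤ s) :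
    x s - y s ≤ A * (M + s) ^ (-α) := by
  have hG : 0 < Real.Gamma (1 - α) := Real.Gamma_pos_of_pos (by linarith)
  set w : ℝ → ℝ := fun τ => x τ - y τ - A * (M + τ) ^ (-α) with hw
  suffices h : w s ≤ 0 by simpa [hw] using h
  have hwc : ContinuousOn w (Ici 0) := (hx.continuousOn.sub hy.continuousOn).sub
    (continuousOn_const.mul (continuousOn_add_rpow hM _))
  -- A maximum over `[0, s]` attained at `t` is also one over `[0, t]`, at its right end point.
  obtain ⟨t, hts, hmax⟩ := isCompact_Icc.exists_isMaxOn (nonempty_Icc.2 hs)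
    (hwc.mono (Icc_subset_Ici_self : Icc 0 s ⊆ _))
  refine (hmax ⟨hs, le_rfl⟩ : w s ≤ w t).trans ?_
  by_contra! hpos
  have ht : 0 < t := by
    refine hts.1.lt_of_ne fun h => ?_
    rw [← h, hw] at hpos
    simp only [hx.initial, hy.initial, add_zero] at hpos
    linarith
  have hphi : 0 ≤ A * (M + t) ^ (-α) := by positivity
  have hxy : 0 < x t - y t := by
    simp only [hw] at hpos
    linarith
  set w' : ℝ → ℝ := fun τ => deriv x τ - deriv y τ - A * (-α * (M + τ) ^ (-α - 1)) with hw'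
  have hie := (hx.caputoDifferentiable t ht).sub (hy.caputoDifferentiable t ht)
  have hiphi : IntervalIntegrable
      (fun τ => A * (-α * (M + τ) ^ (-α - 1) / (t - τ) ^ α)) volume 0 t := by
    simpa only [mul_div_assoc] using
      ((intervalIntegrable_add_rpow_div hα1 hM ht (-α - 1)).const_mul (-α)).const_mul A
  have hfun : (fun τ => w' τ / (t - τ) ^ α) = fun τ =>
      (deriv x τ / (t - τ) ^ α - deriv y τ / (t - τ) ^ α) -
        A * (-α * (M + τ) ^ (-α - 1) / (t - τ) ^ α) := by
    ext τ
    simp only [hw']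
    ring
  have hnonneg : 0 ≤ ∫ τ in (0 : ℝ)..t, w' τ / (t - τ) ^ α := by
    refine integral_deriv_div_rpow_nonneg_of_max hα0 hα1 ht (hwc.mono Icc_subset_Ici_self)
      (fun τ hτ => ((hx.hasDerivAt hτ.1).sub (hy.hasDerivAt hτ.1)).sub
        ((hasDerivAt_add_rpow_neg (add_pos hM hτ.1) α).const_mul A)) ?_ ?_
      fun τ hτ => hmax ⟨hτ.1, hτ.2.trans hts.2⟩
    · refine ContinuousOn.sub (ContinuousOn.sub ?_ ?_) ?_
      · exact (hx.contDiffOn.continuousOn_deriv_of_isOpen isOpen_Ioi le_rfl).mono Ioo_subset_Ioi_self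
      · exact (hy.contDiffOn.continuousOn_deriv_of_isOpen isOpen_Ioi le_rfl).mono Ioo_subset_Ioi_self
      · exact continuousOn_const.mul (continuousOn_const.mul
          ((continuousOn_add_rpow hM _).mono fun τ hτ => hτ.1.le))
    · rw [hfun]
      exact hie.sub hiphi
  rw [hfun, intervalIntegral.integral_sub hie hiphi,
    intervalIntegral.integral_sub (hx.caputoDifferentiable t ht) (hy.caputoDifferentiable t ht),
    intervalIntegral.integral_const_mul] at hnonneg
  have hex := hx.equation t ht
  have hey := hy.equation t ht
  rw [caputoDeriv] at hex hey
  have hmul := mul_nonneg (one_div_pos.2 hG).le hnonneg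
  have hsup := mul_le_mul_of_nonneg_left (hsuper t ht) hA0
  have hlip : f (x t) - f (y t) ≤ lam * (x t - y t) := by
    have h := hf (x t) (y t)
    simp only [RCLike.inner_apply, conj_trivial, Real.norm_eq_abs, sq_abs] at h
    refine le_of_mul_le_mul_right ?_ hxy
    linarith
  have hlw : lam * (x t - y t - A * (M + t) ^ (-α)) < 0 := mul_neg_of_neg_of_pos hlam hpos
  rw [mul_sub, mul_sub, hex, hey] at hmul
  linarith

theorem theorem2p1 (α : ℝ) (hα0 : 0 < α) (hα1 : α < 1) (lam : ℝ) (hlam : lam < 0) :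
    ∃ c : ℝ, 0 < c ∧ ∃ T : ℝ, 0 < T ∧
      ∀ f : ℝ → ℝ, OneSidedLipschitz lam f →
        ∀ (x₀ y₀ : ℝ) (x y : ℝ → ℝ),
          IsCaputoSolution α f x₀ x → IsCaputoSolution α f y₀ y →
            ∀ t : ℝ, T ≤ t → ‖x t - y t‖ ≤ ‖x₀ - y₀‖ * (c / t ^ α) := by
  obtain ⟨M, hM, hsuper⟩ := exists_rpow_supersolution hα0 hα1 hlam
  -- `M ^ α` normalizes the barrier to `‖x₀ - y₀‖` at time `0`. The threshold `1` is arbitrary: only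
  -- `t > 0` matters.
  refine ⟨M ^ α, by positivity, 1, one_pos, fun f hf x₀ y₀ x y hx hy t ht => ?_⟩
  have ht0 : 0 < t := one_pos.trans_le ht
  have hA0 : 0 ≤ ‖x₀ - y₀‖ * M ^ α := by positivity
  have hA : ‖x₀ - y₀‖ * M ^ α * M ^ (-α) = ‖x₀ - y₀‖ := by
    rw [mul_assoc, ← Real.rpow_add hM, add_neg_cancel, Real.rpow_zero, mul_one]
  have h1 := IsCaputoSolution.sub_le hα0 hα1 hlam hM hsuper hf hx hy hA0
    (by rw [hA]; exact Real.le_norm_self _) ht0.le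
  have h2 := IsCaputoSolution.sub_le hα0 hα1 hlam hM hsuper hf hy hx hA0
    (by rw [hA, norm_sub_rev]; exact Real.le_norm_self _) ht0.le
  have h3 : ‖x t - y t‖ ≤ ‖x₀ - y₀‖ * M ^ α * (M + t) ^ (-α) := by
    rw [Real.norm_eq_abs (x t - y t), abs_le]
    constructor <;> linarith
  refine h3.trans ?_
  rw [mul_assoc, div_eq_mul_inv, ← Real.rpow_neg ht0.le]
  have h4 : (M + t) ^ (-α) ≤ t ^ (-α) :=
    Real.rpow_le_rpow_of_nonpos ht0 (by linarith) (by linarith)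
  gcongr
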